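/- Let $\alpha,\beta>-1$ and let $n\ge 0$ be an integer. Let $-1=x_0<x_1<\cdots<x_n<1$ be the roots of $(1+x)P_n^{(\alpha,\beta+1)}(x)$, where $P_n^{(\alpha,\beta+1)}$ is the Jacobi polynomial of degree $n$, and let $w_0,\dots,w_n$ be the weights of the interpolatory quadrature rule with nodes $x_0,\dots,x_n$ for the weight function $(1-x)^\alpha(1+x)^\beta$ on $[-1,1]$, that is, $w_j=\int_{-1}^1(1-x)^\alpha(1+x)^\beta\prod_{k\ne j}\frac{x-x_k}{x_j-x_k}\,dx$. Then the simplified barycentric weights for the nodes $x_0,\dots,x_n$ are $$\lambda_j=(-1)^j\sqrt{(1-x_j)\,\delta_j\,w_j},\qquad \delta_0=\beta+1,\quad \delta_j=1\ \ (1\le j\le n);$$ that is, there is a constant $c\neq 0$, independent of $j$, such that $\prod_{k\ne j}\frac{1}{x_j-x_k}=c\,\lambda_j$ for all $j=0,\dots,n$. -/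

import Mathlib

open Polynomial

noncomputable section

/-- The Jacobi polynomial `P_n^{(α,β)}`, normalised by `P_n^{(α,β)}(1) = (α+1)_n / n!`:
`P_n^{(α,β)}(x) = (1/n!) ∑_{k=0}^n (n choose k) (n+α+β+1)_k (α+k+1)_{n-k} ((x-1)/2)^k`,
where `(a)_k = a (a+1) ⋯ (a+k-1)` is the rising factorial. -/
def jacobiPoly (n : ℕ) (α β : ℝ) : ℝ[X] :=
  ∑ k ∈ Finset.range (n + 1),
    C ((n.choose k : ℝ) / (n.factorial : ℝ)
        * (ascPochhammer ℝ k).eval ((n : ℝ) + α + β + 1)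
        * (ascPochhammer ℝ (n - k)).eval (α + (k : ℝ) + 1))
      * (C (1 / 2) * (X - 1)) ^ k

/-- The `j`-th weight of the interpolatory quadrature rule on `[-1,1]` with nodes `x_0, …, x_n`
for the weight function `(1-t)^α (1+t)^β`: the weighted integral of the `j`-th Lagrange
fundamental polynomial. -/
def interpolatoryWeight (α β : ℝ) {n : ℕ} (x : Fin (n + 1) → ℝ) (j : Fin (n + 1)) : ℝ :=
  ∫ t in (-1 : ℝ)..1,
    (1 - t) ^ α * (1 + t) ^ β * (Lagrange.basis Finset.univ x j).eval t

/-- `lam` is a system of simplified barycentric weights for the nodes `x_0, …, x_n`: the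
barycentric weights `1 / ∏_{k ≠ j} (x_j - x_k)` (Mathlib's `Lagrange.nodalWeight`) are
obtained from `lam` by multiplication by one nonzero factor common to all `j`. -/
def IsSimplifiedBarycentricWeights {n : ℕ} (x lam : Fin (n + 1) → ℝ) : Prop :=
  ∃ c : ℝ, c ≠ 0 ∧ ∀ j, Lagrange.nodalWeight Finset.univ x j = c * lam j

end

/-! Let ω = (1+x)p be the nodal polynomial, with p the monic multiple of the Jacobi polynomial. The
barycentric weight at x_j is 1/ω'(x_j), and its sign alternates because the nodes increase. So it
suffices that (1-x_j) δ_j w_j ω'(x_j)² is one positive constant K; this is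
`radau_weight_mul_derivative_sq`.

Since p is orthogonal to lower degrees for the weight with exponents α, β+1, the rule is exact up to
degree 2n. Feeding it a polynomial that vanishes at every node but x_j isolates w_j: p² for j = 0,
and (1+x)q((1-x²)p' + nxp) with q = p/(x-x_j) otherwise. Integration by parts and orthogonality
reduce both integrals to ∫p² against the weight with exponents α, β+1, giving the same K =
(α+β+2+2n)∫p²; the factor δ_0 = β+1 comes from the first of them.

Orthogonality itself comes from the Jacobi differential operator: it is symmetric for the weight,
and the Jacobi polynomial is an eigenvector. -/

/-! ### Integration against the Jacobi weight. -/

theorem intervalIntegrable_jacobiWeight {a b : ℝ} (ha : -1 < a) (hb : -1 < b) :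
    IntervalIntegrable (fun t : ℝ => (1 - t) ^ a * (1 + t) ^ b) MeasureTheory.volume (-1) 1 := by
  have hL : IntervalIntegrable (fun t : ℝ => (1 + t) ^ b) MeasureTheory.volume (-1) 0 := by
    have := (intervalIntegral.intervalIntegrable_rpow' (a := 0) (b := 1) hb).comp_add_left 1
    simpa using this
  have hR : IntervalIntegrable (fun t : ℝ => (1 - t) ^ a) MeasureTheory.volume 0 1 := by
    have := (intervalIntegral.intervalIntegrable_rpow' (a := 1) (b := 0) ha).comp_sub_left 1
    simpa using this
  refine IntervalIntegrable.trans (b := 0) ?_ ?_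
  · refine hL.continuousOn_mul ?_
    rw [Set.uIcc_of_le (by norm_num)]
    refine ContinuousOn.rpow_const (by fun_prop) fun t ht => Or.inl ?_
    linarith [ht.2]
  · refine hR.mul_continuousOn ?_
    rw [Set.uIcc_of_le (by norm_num)]
    refine ContinuousOn.rpow_const (by fun_prop) fun t ht => Or.inl ?_
    linarith [ht.1]

theorem intervalIntegrable_jacobiWeight_mul_eval {a b : ℝ} (ha : -1 < a) (hb : -1 < b)
    (f : ℝ[X]) :
    IntervalIntegrable (fun t : ℝ => (1 - t) ^ a * (1 + t) ^ b * f.eval t)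
      MeasureTheory.volume (-1) 1 :=
  (intervalIntegrable_jacobiWeight ha hb).mul_continuousOn f.continuous.continuousOn

/-- Integration of polynomials on `[-1,1]` against the Jacobi weight `(1-t)^a (1+t)^b`. -/
noncomputable def jacobiIntegral {a b : ℝ} (ha : -1 < a) (hb : -1 < b) : ℝ[X] →ₗ[ℝ] ℝ where
  toFun f := ∫ t in (-1 : ℝ)..1, (1 - t) ^ a * (1 + t) ^ b * f.eval t
  map_add' f g := by
    rw [← intervalIntegral.integral_add (intervalIntegrable_jacobiWeight_mul_eval ha hb f)
      (intervalIntegrable_jacobiWeight_mul_eval ha hb g)]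
    simp only [eval_add, mul_add]
  map_smul' c f := by
    simp only [eval_smul, smul_eq_mul, RingHom.id_apply]
    rw [← intervalIntegral.integral_const_mul]
    congr 1
    ext t
    ring

theorem jacobiIntegral_apply {a b : ℝ} (ha : -1 < a) (hb : -1 < b) (f : ℝ[X]) :
    jacobiIntegral ha hb f = ∫ t in (-1 : ℝ)..1, (1 - t) ^ a * (1 + t) ^ b * f.eval t := rfl

theorem jacobiIntegral_C_mul {a b : ℝ} (ha : -1 < a) (hb : -1 < b) (c : ℝ) (f : ℝ[X]) :
    jacobiIntegral ha hb (C c * f) = c * jacobiIntegral ha hb f := by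
  rw [← smul_eq_C_mul, map_smul, smul_eq_mul]

theorem jacobiIntegral_one_add_X_mul {a b : ℝ} (ha : -1 < a) (hb : -1 < b) (hb' : -1 < b + 1)
    (f : ℝ[X]) :
    jacobiIntegral ha hb ((1 + X) * f) = jacobiIntegral ha hb' f := by
  simp only [jacobiIntegral_apply]
  refine intervalIntegral.integral_congr fun t ht => ?_
  rw [Set.uIcc_of_le (by norm_num)] at ht
  simp only [eval_mul, eval_add, eval_one, eval_X]
  rw [Real.rpow_add_one' (by linarith [ht.1]) (by linarith)]
  ring

theorem jacobiIntegral_sq_pos {a b : ℝ} (ha : -1 < a) (hb : -1 < b) {f : ℝ[X]} (hf : f ≠ 0) :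
    0 < jacobiIntegral ha hb (f ^ 2) := by
  have hnn : ∀ t ∈ Set.Ioc (-1 : ℝ) 1, 0 ≤ (1 - t) ^ a * (1 + t) ^ b * (f ^ 2).eval t := by
    intro t ht
    rw [eval_pow]
    have h1 : 0 ≤ 1 - t := by linarith [ht.2]
    have h2 : 0 ≤ 1 + t := by linarith [ht.1]
    positivity
  rw [jacobiIntegral_apply,
    intervalIntegral.integral_pos_iff_support_of_nonneg_ae' ?_
      (intervalIntegrable_jacobiWeight_mul_eval ha hb _)]
  · refine ⟨by norm_num, ?_⟩
    -- The integrand is positive on the open interval away from the finitely many roots of `f`, a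
    -- set of positive measure.
    have hsub : Set.Ioo (-1 : ℝ) 1 \ (f.roots.toFinset : Set ℝ) ⊆
        (Function.support fun t : ℝ => (1 - t) ^ a * (1 + t) ^ b * (f ^ 2).eval t) ∩
          Set.Ioc (-1) 1 := by
      rintro t ⟨ht, hr⟩
      refine ⟨?_, Set.Ioo_subset_Ioc_self ht⟩
      have h1 : 0 < 1 - t := by linarith [ht.2]
      have h2 : 0 < 1 + t := by linarith [ht.1]
      have h3 : f.eval t ≠ 0 := by simpa [hf] using hr
      have : 0 < (1 - t) ^ a * (1 + t) ^ b * (f ^ 2).eval t := by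
        rw [eval_pow]; positivity
      exact this.ne'
    refine lt_of_lt_of_le ?_ (MeasureTheory.measure_mono hsub)
    rw [MeasureTheory.measure_sdiff_null (Finset.measure_zero _ _)]
    simp
  · rw [Set.uIoc_of_le (by norm_num)]
    exact (MeasureTheory.ae_restrict_mem measurableSet_Ioc).mono hnn

/-- Integration by parts against the Jacobi weight (the Pearson equation of the weight). -/
theorem jacobiIntegral_pearson {a b : ℝ} (ha : -1 < a) (hb : -1 < b) (f : ℝ[X]) :
    jacobiIntegral ha hb
      ((1 - X ^ 2) * derivative f + (C (b - a) - C (a + b + 2) * X) * f) = 0 := by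
  -- The antiderivative vanishes at both endpoints because a+1 and b+1 are positive.
  rw [jacobiIntegral_apply, intervalIntegral.integral_eq_sub_of_hasDerivAt_of_le
    (f := fun t : ℝ => (1 - t) ^ (a + 1) * (1 + t) ^ (b + 1) * f.eval t) (by norm_num) ?_ ?_
    (intervalIntegrable_jacobiWeight_mul_eval ha hb _)]
  · have h1 : a + 1 ≠ 0 := by linarith
    have h2 : b + 1 ≠ 0 := by linarith
    simp [Real.zero_rpow, h1, h2]
  · refine ContinuousOn.mul (ContinuousOn.mul ?_ ?_) f.continuous.continuousOn
    · exact ContinuousOn.rpow_const (by fun_prop) fun t _ => Or.inr (by linarith)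
    · exact ContinuousOn.rpow_const (by fun_prop) fun t _ => Or.inr (by linarith)
  · intro t ht
    have h1 : 0 < 1 - t := by linarith [ht.2]
    have h2 : 0 < 1 + t := by linarith [ht.1]
    have d1 : HasDerivAt (fun t : ℝ => (1 - t) ^ (a + 1)) (-1 * (a + 1) * (1 - t) ^ (a + 1 - 1)) t :=
      ((hasDerivAt_id t).const_sub 1).rpow_const (Or.inl h1.ne')
    have d2 : HasDerivAt (fun t : ℝ => (1 + t) ^ (b + 1)) (1 * (b + 1) * (1 + t) ^ (b + 1 - 1)) t :=
      ((hasDerivAt_id t).const_add 1).rpow_const (Or.inl h2.ne')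
    refine ((d1.mul d2).mul (f.hasDerivAt t)).congr_deriv ?_
    simp only [add_sub_cancel_right, Pi.mul_apply, Real.rpow_add_one h1.ne',
      Real.rpow_add_one h2.ne', eval_add, eval_mul, eval_sub, eval_C, eval_X, eval_one, eval_pow]
    ring

/-- The Jacobi differential operator `(1-x²) y'' + (b - a - (a+b+2) x) y'`. -/
noncomputable def jacobiOperator (a b : ℝ) (f : ℝ[X]) : ℝ[X] :=
  (1 - X ^ 2) * derivative (derivative f) + (C (b - a) - C (a + b + 2) * X) * derivative f

/-- With L the operator, (Lf)g - f(Lg) is the Pearson expression of the Wronskian f'g - fg', so its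
integral vanishes. -/
theorem jacobiIntegral_jacobiOperator_symm {a b : ℝ} (ha : -1 < a) (hb : -1 < b) (f g : ℝ[X]) :
    jacobiIntegral ha hb (jacobiOperator a b f * g) =
      jacobiIntegral ha hb (f * jacobiOperator a b g) := by
  have h := jacobiIntegral_pearson ha hb (derivative f * g - f * derivative g)
  rw [← sub_eq_zero, ← map_sub, ← h]
  congr 1
  simp only [jacobiOperator, derivative_sub, derivative_mul]
  ring

/-! ### Differential equation and orthogonality of Jacobi polynomials. -/

theorem jacobiPoly_eq_comp (n : ℕ) (a b : ℝ) :
    jacobiPoly n a b = (∑ k ∈ Finset.range (n + 1),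
      C ((n.choose k : ℝ) / (n.factorial : ℝ)
        * (ascPochhammer ℝ k).eval ((n : ℝ) + a + b + 1)
        * (ascPochhammer ℝ (n - k)).eval (a + (k : ℝ) + 1)) * X ^ k).comp
      (C (1 / 2) * (X - 1)) := by
  rw [jacobiPoly, sum_comp]
  simp only [mul_comp, C_comp, pow_comp, X_comp]

/-- The coefficients of a hypergeometric polynomial satisfy a two-term recurrence, hence the
polynomial solves the hypergeometric equation. -/
theorem hypergeometric_equation_of_coeff {a s l : ℝ} {P : ℝ[X]}
    (h : ∀ k : ℕ, P.coeff (k + 1) * ((k + 1) * (k + 1 + a)) =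
      P.coeff k * (l - k * (k + s))) :
    (X + X ^ 2) * derivative (derivative P) + (C (a + 1) + C (s + 1) * X) * derivative P =
      C l * P := by
  ext k
  have hk := h k
  have e1 : (X + X ^ 2) * derivative (derivative P) + (C (a + 1) + C (s + 1) * X) * derivative P
    = X * derivative (derivative P) + X * (X * derivative (derivative P)) +
      (C (a + 1) * derivative P + C (s + 1) * (X * derivative P)) := by ring
  rw [e1]
  rcases k with _ | _ | k
  · simp only [coeff_add, mul_coeff_zero, coeff_X_zero, coeff_C_zero, coeff_derivative]
    push_cast at hk ⊢
    linear_combination hk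
  · simp only [coeff_add, coeff_C_mul, coeff_X_mul, mul_coeff_zero, coeff_X_zero, coeff_derivative]
    push_cast at hk ⊢
    linear_combination hk
  · simp only [coeff_add, coeff_C_mul, coeff_X_mul, coeff_derivative]
    push_cast at hk ⊢
    linear_combination hk

theorem jacobiOperator_jacobiPoly {n : ℕ} {a b : ℝ} :
    jacobiOperator a b (jacobiPoly n a b) =
      C (-(n * (n + a + b + 1))) * jacobiPoly n a b := by
  rw [jacobiPoly_eq_comp]
  set P : ℝ[X] := ∑ k ∈ Finset.range (n + 1),
      C ((n.choose k : ℝ) / (n.factorial : ℝ)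
        * (ascPochhammer ℝ k).eval ((n : ℝ) + a + b + 1)
        * (ascPochhammer ℝ (n - k)).eval (a + (k : ℝ) + 1)) * X ^ k with hP
  have hc : ∀ k, P.coeff k = if k ≤ n then (n.choose k : ℝ) / (n.factorial : ℝ)
        * (ascPochhammer ℝ k).eval ((n : ℝ) + a + b + 1)
        * (ascPochhammer ℝ (n - k)).eval (a + (k : ℝ) + 1) else 0 := by
    intro k
    simp only [hP, finsetSum_coeff, coeff_C_mul, coeff_X_pow, mul_ite, mul_one, mul_zero,
      Finset.sum_ite_eq, Finset.mem_range, Nat.lt_succ_iff]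
  have hrec := hypergeometric_equation_of_coeff (a := a) (s := a + b + 1)
    (l := n * (n + a + b + 1)) (P := P) (by
    intro k
    rw [hc, hc]
    rcases lt_trichotomy k n with hk | rfl | hk
    · rw [if_pos (by omega), if_pos (by omega)]
      obtain ⟨m, rfl⟩ : ∃ m, n = k + 1 + m := ⟨n - (k + 1), by omega⟩
      have hch : ((k + 1 + m).choose (k + 1) : ℝ) * (k + 1) = (k + 1 + m).choose k * (m + 1) := by
        have := Nat.choose_succ_right_eq (k + 1 + m) k
        rw [show k + 1 + m - k = m + 1 by omega] at this
        exact_mod_cast this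
      rw [show k + 1 + m - (k + 1) = m by omega, show k + 1 + m - k = m + 1 by omega,
        ascPochhammer_succ_eval, ascPochhammer_succ_left]
      simp only [eval_mul, eval_X, eval_comp, eval_add, eval_one]
      push_cast
      rw [show a + (k : ℝ) + 1 + 1 = a + (k + 1) + 1 by ring]
      generalize eval _ (ascPochhammer ℝ m) = u
      generalize eval _ (ascPochhammer ℝ k) = v
      linear_combination
        (v * u * (k + 1 + a) * ((k + 1 + m) + a + b + 1 + k) / ((k + 1 + m).factorial : ℝ)) * hch
    · rw [if_neg (by omega), if_pos le_rfl]
      ring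
    · rw [if_neg (by omega), if_neg (by omega)]
      ring)
  have hd : ∀ Q : ℝ[X], derivative (Q.comp (C (1 / 2) * (X - 1))) =
      C (1 / 2) * (derivative Q).comp (C (1 / 2) * (X - 1)) := by
    intro Q
    rw [derivative_comp]
    simp
  have hrec' := congrArg (fun Q : ℝ[X] => Q.comp (C (1 / 2) * (X - 1))) hrec
  simp only [add_comp, mul_comp, X_comp, C_comp, pow_comp] at hrec'
  have hC : (C (1 / 2 : ℝ) : ℝ[X]) * 2 = 1 := by
    rw [← C_ofNat, ← C_mul]; norm_num
  simp only [jacobiOperator, hd, derivative_mul, derivative_C, zero_mul, zero_add]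
  generalize (derivative (derivative P)).comp (C (1 / 2) * (X - 1)) = u at *
  generalize (derivative P).comp (C (1 / 2) * (X - 1)) = v at *
  generalize P.comp (C (1 / 2) * (X - 1)) = w at *
  simp only [C_neg, C_add, C_mul, C_sub, C_1, C_ofNat] at hrec' ⊢
  generalize (C (1 / 2 : ℝ) : ℝ[X]) = c at *
  -- With X = 2Y + 1, the Jacobi equation becomes the hypergeometric equation in Y = (X-1)/2, up to
  -- sign.
  have hX : (X : ℝ[X]) = 2 * (c * (X - 1)) + 1 := by linear_combination (-(X - 1)) * hC
  generalize c * (X - 1) = Y at *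
  rw [hX]
  simp only [map_natCast] at hrec' ⊢
  linear_combination -hrec' - (Y + Y ^ 2) * u * (2 * c + 1) * hC
    - (C a + 1 + (C a + C b + 2) * Y) * v * hC

theorem natDegree_jacobiPoly_le (n : ℕ) (a b : ℝ) : (jacobiPoly n a b).natDegree ≤ n := by
  refine natDegree_sum_le_of_forall_le _ _ fun k hk => ?_
  refine (natDegree_C_mul_le _ _).trans ((natDegree_pow_le).trans ?_)
  have : (C (1 / 2 : ℝ) * (X - 1)).natDegree ≤ 1 :=
    (natDegree_C_mul_le _ _).trans (natDegree_X_sub_C (1 : ℝ)).le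
  have := Finset.mem_range.1 hk
  nlinarith

/-- The operator sends X^k to -k(k+a+b+1) X^k plus lower powers. By symmetry and induction the lower
powers drop out, leaving the integral times a difference of eigenvalues. -/
theorem jacobiIntegral_jacobiPoly_mul_X_pow {n k : ℕ} {a b : ℝ} (ha : -1 < a) (hb : -1 < b)
    (hk : k < n) : jacobiIntegral ha hb (jacobiPoly n a b * X ^ k) = 0 := by
  induction k using Nat.strong_induction_on with
  | _ k ih =>
  set p := jacobiPoly n a b
  have hsym := jacobiIntegral_jacobiOperator_symm ha hb p (X ^ k)
  have hkn : (k : ℝ) + 1 ≤ n := by exact_mod_cast hk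
  have hk0 : (0 : ℝ) ≤ k := k.cast_nonneg
  -- Difference of the eigenvalue parameters n(n+a+b+1) and k(k+a+b+1), factored; both factors are
  -- positive since k < n and a+b > -2.
  have hgap : ((n : ℝ) - k) * (n + k + a + b + 1) ≠ 0 :=
    mul_ne_zero (by linarith) (by linarith)
  rw [jacobiOperator_jacobiPoly, mul_assoc, jacobiIntegral_C_mul] at hsym
  refine (mul_eq_zero.1 (?_ : (((n : ℝ) - k) * (n + k + a + b + 1)) * _ = 0)).resolve_left hgap
  rcases k with _ | _ | k
  · have e : p * jacobiOperator a b (X ^ 0) = 0 := by simp [jacobiOperator]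
    rw [e, map_zero] at hsym
    push_cast
    linear_combination -hsym
  · have e : p * jacobiOperator a b (X ^ (0 + 1)) =
        C (b - a) * (p * X ^ 0) - C (a + b + 2) * (p * X ^ (0 + 1)) := by
      simp [jacobiOperator]; ring
    rw [e, map_sub, jacobiIntegral_C_mul, jacobiIntegral_C_mul,
      ih 0 (by omega) (by omega)] at hsym
    push_cast
    linear_combination -hsym
  · have e : p * jacobiOperator a b (X ^ (k + 1 + 1)) =
        C (((k : ℝ) + 2) * (k + 1)) * (p * X ^ k) + C (((k : ℝ) + 2) * (b - a)) * (p * X ^ (k + 1))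
          - C (((k : ℝ) + 2) * (k + 1) + (a + b + 2) * (k + 2)) * (p * X ^ (k + 1 + 1)) := by
      have d1 (m : ℕ) : derivative (X ^ (m + 1) : ℝ[X]) = C ((m : ℝ) + 1) * X ^ m := by
        simp
      rw [jacobiOperator, d1, derivative_C_mul, d1]
      push_cast
      simp only [C_add, C_mul, C_sub, C_1, C_ofNat]
      ring
    rw [e, map_sub, map_add, jacobiIntegral_C_mul, jacobiIntegral_C_mul, jacobiIntegral_C_mul,
      ih k (by omega) (by omega), ih (k + 1) (by omega) (by omega)] at hsym
    push_cast
    linear_combination -hsym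

theorem jacobiIntegral_jacobiPoly_mul_eq_zero {n : ℕ} {a b : ℝ} (ha : -1 < a) (hb : -1 < b)
    {q : ℝ[X]} (hq : q.degree < n) : jacobiIntegral ha hb (jacobiPoly n a b * q) = 0 := by
  rw [q.as_sum_range_C_mul_X_pow, Finset.mul_sum, map_sum]
  refine Finset.sum_eq_zero fun k hk => ?_
  rcases eq_or_ne (q.coeff k) 0 with h | h
  · simp [h]
  · have : k < n := by
      have := (le_degree_of_ne_zero h).trans_lt hq
      exact_mod_cast this
    rw [mul_left_comm, jacobiIntegral_C_mul, jacobiIntegral_jacobiPoly_mul_X_pow ha hb this,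
      mul_zero]

/-- Serves to read off leading coefficients, and to bound degrees when the top terms cancel. -/
theorem coeff_succ_pearson (f : ℝ[X]) (d e : ℝ) (k : ℕ) :
    ((1 - X ^ 2) * derivative f + (C e - C d * X) * f).coeff (k + 1) =
      f.coeff (k + 2) * (k + 2) - k * f.coeff k + e * f.coeff (k + 1) - d * f.coeff k := by
  have h : (1 - X ^ 2) * derivative f + (C e - C d * X) * f =
      derivative f - X * (X * derivative f) + C e * f - C d * (X * f) := by ring
  rw [h]
  rcases k with _ | k
  · simp only [coeff_add, coeff_sub, coeff_C_mul, coeff_X_mul, mul_coeff_zero, coeff_X_zero,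
      coeff_derivative]
    push_cast
    ring
  · simp only [coeff_add, coeff_sub, coeff_C_mul, coeff_X_mul, coeff_derivative]
    push_cast
    ring

/-- Sign of the barycentric weights for increasing nodes. -/
theorem nodalWeight_eq_neg_one_pow_mul_abs {n : ℕ} {x : Fin (n + 1) → ℝ} (hx : StrictMono x)
    (j : Fin (n + 1)) :
    Lagrange.nodalWeight Finset.univ x j =
      (-1) ^ n * (-1) ^ (j : ℕ) * |Lagrange.nodalWeight Finset.univ x j| := by
  have h : ∀ k ∈ Finset.univ.erase j, (x j - x k)⁻¹ =
      (if j < k then (-1 : ℝ) else 1) * |(x j - x k)⁻¹| := by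
    intro k hk
    have hkj := Finset.ne_of_mem_erase hk
    split_ifs with hlt
    · rw [abs_of_neg (inv_lt_zero.2 (sub_neg.2 (hx hlt)))]
      ring
    · have := hx (lt_of_le_of_ne (not_lt.1 hlt) hkj)
      rw [abs_of_pos (inv_pos.2 (sub_pos.2 this)), one_mul]
  have hfilter : (Finset.univ.erase j).filter (fun k => j < k) = Finset.Ioi j := by
    ext k
    simp only [Finset.mem_filter, Finset.mem_erase, Finset.mem_univ, and_true, Finset.mem_Ioi]
    exact ⟨fun h => h.2, fun h => ⟨h.ne', h⟩⟩
  have hsign : (-1 : ℝ) ^ (n - (j : ℕ)) = (-1) ^ n * (-1) ^ (j : ℕ) := by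
    have hjn : n - (j : ℕ) + j = n := by omega
    conv_rhs => rw [← pow_add, ← congrArg (· + (j : ℕ)) hjn]
    simp only [pow_add, mul_assoc, ← mul_pow, neg_one_mul, neg_neg, one_pow, mul_one]
  conv_lhs => rw [Lagrange.nodalWeight, Finset.prod_congr rfl h, Finset.prod_mul_distrib,
    Finset.prod_ite, Finset.prod_const, Finset.prod_const_one, hfilter, Fin.card_Ioi, mul_one,
    ← Finset.abs_prod]
  rw [show n + 1 - 1 - (j : ℕ) = n - j by omega, hsign]
  rfl

/-! ### Integral identities for a monic orthogonal polynomial. -/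

section MonicOrthogonal

variable {n : ℕ} {a b : ℝ} (ha : -1 < a) (hb : -1 < b) {p : ℝ[X]}

/-- Subtracting from q the multiple of p with the same coefficient of X^n leaves degree below n,
which p annihilates. -/
theorem jacobiIntegral_mul_eq_coeff_mul (hp : p.Monic) (hn : p.natDegree = n)
    (horth : ∀ q : ℝ[X], q.degree < n → jacobiIntegral ha hb (p * q) = 0)
    {q : ℝ[X]} (hq : q.natDegree ≤ n) :
    jacobiIntegral ha hb (p * q) = q.coeff n * jacobiIntegral ha hb (p ^ 2) := by
  have h := horth (q - C (q.coeff n) * p) <| by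
    rw [degree_lt_iff_coeff_zero]
    intro m hm
    rw [coeff_sub, coeff_C_mul]
    rcases hm.eq_or_lt with rfl | hm
    · rw [← hn, hp.coeff_natDegree, mul_one, sub_self]
    · rw [coeff_eq_zero_of_natDegree_lt (hq.trans_lt hm),
        coeff_eq_zero_of_natDegree_lt (hn.trans_lt hm), mul_zero, sub_zero]
  rw [show p * (q - C (q.coeff n) * p) = p * q - C (q.coeff n) * p ^ 2 by ring, map_sub,
    jacobiIntegral_C_mul] at h
  linarith

theorem jacobiIntegral_sq_of_orthogonal (hb' : -1 < b + 1) (hp : p.Monic) (hn : p.natDegree = n)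
    (horth : ∀ q : ℝ[X], q.degree < n → jacobiIntegral ha hb' (p * q) = 0) :
    2 * (b + 1) * jacobiIntegral ha hb (p ^ 2) =
      (a + b + 2 + 2 * n) * jacobiIntegral ha hb' (p ^ 2) := by
  have h := jacobiIntegral_pearson ha hb (p ^ 2)
  -- Uses b - a - (a+b+2)X = 2(b+1) - (a+b+2)(1+X); the factor 1+X then raises the exponent b by
  -- one.
  have e : (1 - X ^ 2) * derivative (p ^ 2) + (C (b - a) - C (a + b + 2) * X) * p ^ 2 =
      C (2 * (b + 1)) * p ^ 2 + (1 + X) * (C (1 + 1) * (p * derivative p) -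
        C (1 + 1) * (p * (X * derivative p)) - C (a + b + 2) * p ^ 2) := by
    simp only [sq p, derivative_mul, C_add, C_sub, C_mul, C_ofNat, C_1]
    ring
  have hd : (derivative p).natDegree ≤ n - 1 := hn ▸ natDegree_derivative_le p
  have h1 : jacobiIntegral ha hb' (p * derivative p) = 0 := by
    rw [jacobiIntegral_mul_eq_coeff_mul ha hb' hp hn horth (hd.trans (by omega)),
      coeff_derivative, coeff_eq_zero_of_natDegree_lt (by omega)]
    ring
  have h2 : jacobiIntegral ha hb' (p * (X * derivative p)) = n * jacobiIntegral ha hb' (p ^ 2) := by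
    -- For n = 0 the truncated bound n - 1 on the degree of p' would only give degree 1 for X p'.
    rcases n with _ | m
    · rw [derivative_of_natDegree_zero hn]
      simp
    · rw [jacobiIntegral_mul_eq_coeff_mul ha hb' hp hn horth, coeff_X_mul, coeff_derivative, ← hn,
        hp.coeff_natDegree]
      · rw [hn]; push_cast; ring
      · refine natDegree_mul_le.trans ?_
        rw [natDegree_X]
        omega
  rw [e, map_add, jacobiIntegral_one_add_X_mul ha hb hb', map_sub, map_sub] at h
  simp only [jacobiIntegral_C_mul] at h
  rw [h1, h2] at h
  linarith

/-- The Pearson identity for pq produces the left side plus p times polynomials of degree at most n,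
and these contribute only through their coefficients of X^n. -/
theorem jacobiIntegral_divided_mul (hp : p.Monic) (hn : p.natDegree = n)
    (horth : ∀ q : ℝ[X], q.degree < n → jacobiIntegral ha hb (p * q) = 0)
    {y : ℝ} {q : ℝ[X]} (hq : p = (X - C y) * q) :
    jacobiIntegral ha hb (q * ((1 - X ^ 2) * derivative p + C (n : ℝ) * X * p)) =
      (a + b + 1 + 2 * n) * jacobiIntegral ha hb (p ^ 2) := by
  have hqm : q.Monic := (monic_X_sub_C y).of_mul_monic_left (hq ▸ hp)
  obtain ⟨m, rfl⟩ : ∃ m, n = m + 1 := ⟨q.natDegree, by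
    rw [← hn, hq, (monic_X_sub_C y).natDegree_mul hqm, natDegree_X_sub_C, add_comm]⟩
  have hqd : q.natDegree = m := by
    rw [hq, (monic_X_sub_C y).natDegree_mul hqm, natDegree_X_sub_C] at hn
    omega
  have hz : ∀ k, m < k → q.coeff k = 0 := fun k hk =>
    coeff_eq_zero_of_natDegree_lt (hqd.trans_lt hk)
  have h1 : q.coeff m = 1 := hqd ▸ hqm.coeff_natDegree
  have h := jacobiIntegral_pearson ha hb (p * q)
  have e : (1 - X ^ 2) * derivative (p * q) + (C (b - a) - C (a + b + 2) * X) * (p * q) =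
      q * ((1 - X ^ 2) * derivative p + C (((m + 1 : ℕ) : ℝ)) * X * p)
      + p * ((1 - X ^ 2) * derivative q + (C (b - a) - C (a + b + 2) * X) * q)
      - C ((m + 1 : ℕ) : ℝ) * (p * (X * q)) := by
    rw [derivative_mul]
    ring
  rw [e, map_sub, map_add, jacobiIntegral_C_mul,
    jacobiIntegral_mul_eq_coeff_mul ha hb hp hn horth (q := X * q),
    jacobiIntegral_mul_eq_coeff_mul ha hb hp hn horth (q := _ + _),
    coeff_X_mul, coeff_succ_pearson, hz (m + 2) (by omega), hz (m + 1) (by omega), h1] at h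
  · push_cast at h ⊢
    linear_combination h
  · rw [natDegree_le_iff_coeff_eq_zero]
    rintro (_ | k) hk
    · omega
    · rw [coeff_succ_pearson, hz _ (by omega), hz _ (by omega), hz _ (by omega)]
      ring
  · refine natDegree_mul_le.trans ?_
    rw [natDegree_X]
    omega

end MonicOrthogonal

/-! ### Exactness and weights of the Gauss–Radau rule. -/

section Radau

variable {n : ℕ} {α β : ℝ} {x : Fin (n + 1) → ℝ} {p : ℝ[X]}

/-- The Gauss–Radau rule is exact up to degree `2n`. -/
theorem jacobiIntegral_eq_sum_interpolatoryWeight (hα : -1 < α) (hβ : -1 < β)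
    (hβ' : -1 < β + 1) (hx : Function.Injective x)
    (hnodal : Lagrange.nodal Finset.univ x = (1 + X) * p)
    (horth : ∀ q : ℝ[X], q.degree < n → jacobiIntegral hα hβ' (p * q) = 0)
    {f : ℝ[X]} (hf : f.natDegree ≤ 2 * n) :
    jacobiIntegral hα hβ f = ∑ j, interpolatoryWeight α β x j * f.eval (x j) := by
  set ω := Lagrange.nodal Finset.univ x with hω
  have hωm : ω.Monic := Lagrange.nodal_monic
  have hωd : ω.natDegree = n + 1 := by simp [hω]
  -- The quotient has degree at most 2n - (n+1). A zero quotient is treated apart, so that n = 0 is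
  -- covered by degree ⊥.
  have hQ : (f /ₘ ω).degree < n := by
    by_cases h : f.degree < ω.degree
    · rw [(divByMonic_eq_zero_iff hωm).2 h, degree_zero]
      exact WithBot.bot_lt_coe n
    · have h' := natDegree_le_natDegree (not_lt.1 h)
      refine degree_le_natDegree.trans_lt ?_
      rw [natDegree_divByMonic f hωm]
      exact_mod_cast (by omega : f.natDegree - ω.natDegree < n)
  have hR : (f %ₘ ω).degree < (Finset.univ : Finset (Fin (n + 1))).card := by
    refine (degree_modByMonic_lt f hωm).trans_le ?_
    rw [hω, Lagrange.degree_nodal]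
  have heval : ∀ j, (f %ₘ ω).eval (x j) = f.eval (x j) := by
    intro j
    have := congrArg (eval (x j)) (modByMonic_add_div f ω)
    rwa [eval_add, eval_mul, hω, Lagrange.eval_nodal_at_node (Finset.mem_univ j), zero_mul,
      add_zero] at this
  conv_lhs => rw [← modByMonic_add_div f ω]
  rw [map_add, hnodal, mul_assoc, jacobiIntegral_one_add_X_mul hα hβ hβ', ← hnodal, horth _ hQ,
    add_zero, Lagrange.eq_interpolate hx.injOn hR, Lagrange.interpolate_apply, map_sum]
  refine Finset.sum_congr rfl fun j _ => ?_
  rw [jacobiIntegral_C_mul, heval, mul_comm]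
  rfl

/-- Each test polynomial has degree at most 2n and vanishes at all nodes except x_j, so its integral
is a single term of the quadrature sum. -/
theorem radau_weight_mul_derivative_sq (hα : -1 < α) (hβ : -1 < β)
    (hβ' : -1 < β + 1) (hx : Function.Injective x) (hfirst : x 0 = -1)
    (hnodal : Lagrange.nodal Finset.univ x = (1 + X) * p)
    (hp : p.Monic) (hn : p.natDegree = n)
    (horth : ∀ q : ℝ[X], q.degree < n → jacobiIntegral hα hβ' (p * q) = 0) (j : Fin (n + 1)) :
    (1 - x j) * (if j = 0 then β + 1 else 1) * interpolatoryWeight α β x j *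
        (derivative (Lagrange.nodal Finset.univ x)).eval (x j) ^ 2 =
      (α + β + 2 + 2 * n) * jacobiIntegral hα hβ' (p ^ 2) := by
  have hnode : ∀ k, (1 + x k) * p.eval (x k) = 0 := fun k => by
    have := Lagrange.eval_nodal_at_node (v := x) (Finset.mem_univ k)
    rw [hnodal] at this
    simpa using this
  have hpx : ∀ k, k ≠ 0 → p.eval (x k) = 0 := fun k hk => by
    refine (mul_eq_zero.1 (hnode k)).resolve_left fun h => hk (hx ?_)
    linarith
  have hder : (derivative ((1 + X) * p)).eval (x j) =
      p.eval (x j) + (1 + x j) * (derivative p).eval (x j) := by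
    simp
  rw [hnodal, hder]
  by_cases hj : j = 0
  · subst hj
    have hquad := jacobiIntegral_eq_sum_interpolatoryWeight hα hβ hβ' hx hnodal horth (f := p ^ 2)
      (by rw [natDegree_pow, hn])
    rw [Finset.sum_eq_single 0] at hquad
    · rw [← jacobiIntegral_sq_of_orthogonal hα hβ hβ' hp hn horth, hquad, if_pos rfl, eval_pow,
        hfirst]
      ring
    · intro k _ hk
      rw [eval_pow, hpx k hk]
      ring
    · simp
  · obtain ⟨q, hq⟩ := dvd_iff_isRoot.2 (hpx j hj)
    have hqm : q.Monic := (monic_X_sub_C (x j)).of_mul_monic_left (hq ▸ hp)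
    have hqd : q.natDegree + 1 = n := by
      rw [← hn, hq, (monic_X_sub_C (x j)).natDegree_mul hqm, natDegree_X_sub_C, add_comm]
    set g := (1 - X ^ 2) * derivative p + C (n : ℝ) * X * p with hg
    have hgd : g.natDegree ≤ n := by
      -- In Pearson form with d = -n and e = 0, the coefficient of X^(n+1) is -n + n = 0. This
      -- cancellation is why the term nXp was added.
      have e : g = (1 - X ^ 2) * derivative p + (C 0 - C (-(n : ℝ)) * X) * p := by
        rw [hg, C_neg, C_0]
        ring
      rw [e, natDegree_le_iff_coeff_eq_zero]
      rintro (_ | k) hk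
      · omega
      · rw [coeff_succ_pearson, coeff_eq_zero_of_natDegree_lt (n := k + 2) (by omega)]
        rcases (Nat.lt_succ_iff.1 hk).eq_or_lt with rfl | hk
        · ring
        · rw [coeff_eq_zero_of_natDegree_lt (n := k) (by omega)]
          ring
    have hint := jacobiIntegral_divided_mul hα hβ' hp hn horth hq
    rw [← hg, ← jacobiIntegral_one_add_X_mul hα hβ hβ',
      jacobiIntegral_eq_sum_interpolatoryWeight hα hβ hβ' hx hnodal horth,
      Finset.sum_eq_single j] at hint
    · have hdp : (derivative p).eval (x j) = q.eval (x j) := by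
        rw [hq, derivative_mul]
        simp
      have hgj : g.eval (x j) = (1 - x j ^ 2) * q.eval (x j) := by
        rw [hg]
        simp [hpx j hj, hdp]
      rw [eval_mul, eval_mul, hgj, eval_add, eval_one, eval_X] at hint
      rw [hpx j hj, hdp, if_neg hj]
      linear_combination hint
    · intro k _ hk
      have h := congrArg (fun f : ℝ[X] => ((1 + X) * f * g).eval (x k)) hq
      simp only [eval_mul, eval_add, eval_one, eval_X, eval_sub, eval_C, hnode, zero_mul] at h
      have hne : x k - x j ≠ 0 := sub_ne_zero.2 (hx.ne hk)
      have h0 : ((1 + X) * (q * g)).eval (x k) = 0 := by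
        -- Multiplying by x_k - x_j restores (1+x)p, which vanishes at every node.
        refine (mul_eq_zero.1 (?_ : (x k - x j) * _ = 0)).resolve_left hne
        simp only [eval_mul, eval_add, eval_one, eval_X]
        linear_combination -h
      rw [h0, mul_zero]
    · simp
    · have h1 : (1 + X : ℝ[X]).natDegree ≤ 1 := by
        rw [add_comm]; exact (natDegree_X_add_C (1 : ℝ)).le
      have h2 := natDegree_mul_le (p := (1 + X : ℝ[X])) (q := q * g)
      have h3 := natDegree_mul_le (p := q) (q := g)
      omega

end Radau

/-- A polynomial `(1+x) P_n^{(a,b)}` with `n+1` distinct real roots is a constant multiple of the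
nodal polynomial of its roots. -/
theorem jacobiPoly_eq_C_mul_prod {n : ℕ} {a b : ℝ} {x : Fin (n + 1) → ℝ} (hx : StrictMono x)
    (hfirst : x 0 = -1) (hlast : x (Fin.last n) < 1)
    (hroots : ∀ y : ℝ, ((1 + X) * jacobiPoly n a b).IsRoot y ↔ ∃ j, x j = y) :
    ∃ c : ℝ, c ≠ 0 ∧ jacobiPoly n a b = C c * ∏ i : Fin n, (X - C (x i.succ)) := by
  have h1X : (1 + X : ℝ[X]) = X - C (x 0) := by
    rw [hfirst, C_neg, C_1]; ring
  have hne : (1 + X) * jacobiPoly n a b ≠ 0 := by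
    intro h
    -- If the product were zero, 1 would be a root and hence a node, but all nodes are below 1.
    obtain ⟨j, hj⟩ := (hroots 1).1 (by rw [h]; simp)
    have := hx.monotone (Fin.le_last j)
    linarith
  obtain ⟨r, hr⟩ : (∏ j, (X - C (x j))) ∣ (1 + X) * jacobiPoly n a b :=
    Finset.prod_dvd_of_coprime
      (fun i _ j _ hij => pairwise_coprime_X_sub_C hx.injective hij)
      fun j _ => dvd_iff_isRoot.2 ((hroots _).2 ⟨j, rfl⟩)
  have hr0 : r ≠ 0 := by
    rintro rfl
    exact hne (by rw [hr, mul_zero])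
  have hrd : r.natDegree = 0 := by
    have hd := congrArg natDegree hr
    rw [Monic.natDegree_mul' (monic_prod_of_monic _ _ fun j _ => monic_X_sub_C _) hr0,
      natDegree_prod_of_monic _ _ fun j _ => monic_X_sub_C _] at hd
    simp only [natDegree_X_sub_C, Finset.sum_const, Finset.card_univ, Fintype.card_fin,
      smul_eq_mul, mul_one] at hd
    have h2 := natDegree_mul_le (p := (1 + X : ℝ[X])) (q := jacobiPoly n a b)
    rw [h1X, natDegree_X_sub_C, ← h1X] at h2
    have := natDegree_jacobiPoly_le n a b
    omega
  obtain ⟨c, rfl⟩ := natDegree_eq_zero.1 hrd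
  refine ⟨c, by rintro rfl; simp at hr0, ?_⟩
  rw [Fin.prod_univ_succ, h1X, mul_assoc] at hr
  rw [mul_left_cancel₀ (X_sub_C_ne_zero _) hr, mul_comm]

/-! ### The barycentric weights. -/

theorem corollary3p5 (n : ℕ) (α β : ℝ) (hα : -1 < α) (hβ : -1 < β)
    (x : Fin (n + 1) → ℝ) (hmono : StrictMono x)
    (hfirst : x 0 = -1) (hlast : x (Fin.last n) < 1)
    (hroots : ∀ y : ℝ, ((1 + X) * jacobiPoly n α (β + 1)).IsRoot y ↔ ∃ j, x j = y) :
    IsSimplifiedBarycentricWeights x (fun j =>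
      (-1) ^ (j : ℕ) *
        Real.sqrt ((1 - x j) * (if j = 0 then β + 1 else 1) * interpolatoryWeight α β x j)) := by
  have hβ' : -1 < β + 1 := by linarith
  obtain ⟨c, hc, hjac⟩ := jacobiPoly_eq_C_mul_prod hmono hfirst hlast hroots
  set p : ℝ[X] := ∏ i : Fin n, (X - C (x i.succ)) with hpdef
  have hp : p.Monic := monic_prod_of_monic _ _ fun i _ => monic_X_sub_C _
  have hn : p.natDegree = n := by
    rw [hpdef, natDegree_prod_of_monic _ _ fun i _ => monic_X_sub_C _]
    simp
  have hnodal : Lagrange.nodal Finset.univ x = (1 + X) * p := by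
    rw [Lagrange.nodal, Fin.prod_univ_succ, hfirst, C_neg, C_1, sub_neg_eq_add, add_comm X]
  have horth : ∀ q : ℝ[X], q.degree < n → jacobiIntegral hα hβ' (p * q) = 0 := by
    intro q hq
    have h := jacobiIntegral_jacobiPoly_mul_eq_zero hα hβ' hq
    rw [hjac, mul_assoc, jacobiIntegral_C_mul] at h
    exact (mul_eq_zero.1 h).resolve_left hc
  set K := (α + β + 2 + 2 * n) * jacobiIntegral hα hβ' (p ^ 2) with hK
  have hKpos : 0 < K := by
    have : (0 : ℝ) ≤ n := n.cast_nonneg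
    exact mul_pos (by linarith) (jacobiIntegral_sq_pos hα hβ' hp.ne_zero)
  have hsK : Real.sqrt K ≠ 0 := (Real.sqrt_pos.2 hKpos).ne'
  -- There are n - j nodes to the right of x_j, so the sign is (-1)^(n-j) = (-1)^n (-1)^j; the
  -- modulus is the square root of (1-x_j) δ_j w_j / K.
  refine ⟨(-1) ^ n / Real.sqrt K, div_ne_zero (pow_ne_zero _ (by norm_num)) hsK, fun j => ?_⟩
  have hkey := radau_weight_mul_derivative_sq hα hβ hβ' hmono.injective hfirst hnodal hp hn horth j
  have hw := Lagrange.nodalWeight_eq_eval_derivative_nodal (v := x) (Finset.mem_univ j)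
  have hw0 := Lagrange.nodalWeight_ne_zero hmono.injective.injOn (Finset.mem_univ j)
  rw [hw] at hw0
  rw [← hK] at hkey
  have hsq : (1 - x j) * (if j = 0 then β + 1 else 1) * interpolatoryWeight α β x j =
      K * Lagrange.nodalWeight Finset.univ x j ^ 2 := by
    rw [hw, ← hkey, mul_assoc _ (_ ^ 2), ← mul_pow, mul_inv_cancel₀ (inv_eq_zero.not.1 hw0), one_pow,
      mul_one]
  beta_reduce
  rw [hsq, Real.sqrt_mul hKpos.le, Real.sqrt_sq_eq_abs]
  conv_lhs => rw [nodalWeight_eq_neg_one_pow_mul_abs hmono j]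
  field_simp
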